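/- Let $d\ge 1$, $R>0$, let $|\cdot|$ be the Euclidean norm on $\mathbb{R}^d$, $B(z,\rho)=\{x\in\mathbb{R}^d:|x-z|<\rho\}$ and $S^{d-1}=\{x\in\mathbb{R}^d:|x|=1\}$. For $\mathcal{K}\subset S^{d-1}$ put $$C_{\mathcal{K}}=\bigcap_{v\in\mathcal{K}}\big(\mathbb{R}^d\setminus B(Rv,R)\big),$$ and call $\mathcal{K}$ spherically convex if $\mathrm{co}(K)\cap S^{d-1}=\mathcal{K}$, where $K=\{\lambda v: v\in\mathcal{K},\ \lambda\ge 0\}$ and $\mathrm{co}$ is the convex hull. For a nonempty closed set $A\subset\mathbb{R}^d$ and $q\in A$ let $$\mathrm{Tan}(A,q)=\{v\in\mathbb{R}^d:\ \forall \varepsilon>0\ \exists x\in A\cap B(q,\varepsilon)\ \exists r>0,\ |r(x-q)-v|<\varepsilon\},$$ $$\mathrm{Nor}(A,q)=\{u\in\mathbb{R}^d:\ \langle u,v\rangle\le 0\ \ \forall v\in\mathrm{Tan}(A,q)\},$$ let $\mathrm{Unp}(A)$ be the set of points of $\mathbb{R}^d$ that have a unique nearest point in $A$, and let $$\mathrm{reach}(A)=\inf_{a\in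 A}\ \sup\{\rho>0: B(a,\rho)\subset \mathrm{Unp}(A)\}\in[0,\infty],$$ where $\sup\emptyset=0$. Let $\mathcal{K}$ be a nonempty closed subset of $S^{d-1}$ that is contained in a closed hemisphere $\{v\in S^{d-1}:\langle u,v\rangle\ge 0\}$, for some $u\in S^{d-1}$, and let $\mathcal{N}=\mathrm{Nor}(C_{\mathcal{K}},o)\cap S^{d-1}$, where $o$ is the origin. Then the following properties are equivalent: a) $\mathcal{K}$ is spherically convex; b) $\mathrm{reach}(C_{\mathcal{K}})\ge R$; c) $C_{\mathcal{K}}=C_{\mathcal{N}}$. -/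

import Mathlib

open scoped ENNReal

namespace RBody

noncomputable section

variable {d : ℕ}

/-- The tangent cone (in the sense of Federer) of `A` at `q`. -/
def Tan (A : Set (EuclideanSpace ℝ (Fin d))) (q : EuclideanSpace ℝ (Fin d)) :
    Set (EuclideanSpace ℝ (Fin d)) :=
  {v | ∀ ε : ℝ, 0 < ε → ∃ x ∈ A ∩ Metric.ball q ε, ∃ r : ℝ, 0 < r ∧ ‖r • (x - q) - v‖ < ε}

/-- The normal cone of `A` at `q`. -/
def Nor (A : Set (EuclideanSpace ℝ (Fin d))) (q : EuclideanSpace ℝ (Fin d)) :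
    Set (EuclideanSpace ℝ (Fin d)) :=
  {u | ∀ v ∈ Tan A q, inner ℝ u v ≤ 0}

/-- The points with a unique nearest point in `A`. -/
def Unp (A : Set (EuclideanSpace ℝ (Fin d))) : Set (EuclideanSpace ℝ (Fin d)) :=
  {x | ∃! b, b ∈ A ∧ dist x b = Metric.infDist x A}

/-- `reach(A, a)`, the supremum of all `ρ > 0` with `B(a, ρ) ⊆ Unp(A)`; it is `0` if there is no
such `ρ`, and `∞` if `ρ` may be arbitrarily large. -/
def reachAt (A : Set (EuclideanSpace ℝ (Fin d))) (a : EuclideanSpace ℝ (Fin d)) : ℝ≥0∞ :=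
  sSup {t | ∃ ρ : ℝ, 0 < ρ ∧ Metric.ball a ρ ⊆ Unp A ∧ t = ENNReal.ofReal ρ}

/-- `reach(A)`, the infimum of `reach(A, a)` over `a ∈ A`. -/
def reach (A : Set (EuclideanSpace ℝ (Fin d))) : ℝ≥0∞ :=
  ⨅ a ∈ A, reachAt A a

/-- The cone `{λ v : v ∈ 𝒦, λ ≥ 0}` related to a subset `𝒦` of the unit sphere. -/
def relatedCone (𝒦 : Set (EuclideanSpace ℝ (Fin d))) : Set (EuclideanSpace ℝ (Fin d)) :=
  {x | ∃ v ∈ 𝒦, ∃ c : ℝ, 0 ≤ c ∧ x = c • v}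

/-- The spherical convex hull of a subset of the unit sphere. -/
def sphHull (𝒦 : Set (EuclideanSpace ℝ (Fin d))) : Set (EuclideanSpace ℝ (Fin d)) :=
  convexHull ℝ (relatedCone 𝒦) ∩ Metric.sphere 0 1

/-- A subset of the unit sphere is spherically convex if it is its own spherical convex hull. -/
def SphConvex (𝒦 : Set (EuclideanSpace ℝ (Fin d))) : Prop :=
  sphHull 𝒦 = 𝒦

/-- The `R`-cone with vertex at the origin determined by `𝒦`. -/
def RCone (R : ℝ) (𝒦 : Set (EuclideanSpace ℝ (Fin d))) : Set (EuclideanSpace ℝ (Fin d)) :=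
  ⋂ v ∈ 𝒦, (Metric.ball (R • v) R)ᶜ

/-- The unit normal directions of `A` at `q`. -/
def unitNor (A : Set (EuclideanSpace ℝ (Fin d))) (q : EuclideanSpace ℝ (Fin d)) :
    Set (EuclideanSpace ℝ (Fin d)) :=
  Nor A q ∩ Metric.sphere 0 1

/-- The closed hemisphere of the unit sphere with pole `u`. -/
def hemisphere (u : EuclideanSpace ℝ (Fin d)) : Set (EuclideanSpace ℝ (Fin d)) :=
  {v | v ∈ Metric.sphere (0 : EuclideanSpace ℝ (Fin d)) 1 ∧ 0 ≤ inner ℝ u v}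

end

end RBody

open scoped ENNReal

namespace RBody

open Filter Topology
open scoped Pointwise

variable {d : ℕ}

local notation "𝔼" => EuclideanSpace ℝ (Fin d)

/-! ### Basic description of the `R`-cone -/

/-! Membership in the `R`-cone is a family of quadratic inequalities `2R⟪x, v⟫ ≤ ‖x‖²`. To first
order at the origin these say `⟪x, v⟫ ≤ 0`, so the tangent cone there is the polar of `𝒦` and the
normal cone its bipolar, which is the cone over `𝒦` when `𝒦` is spherically convex (a → c).

Both converses rest on `mem_of_RCone_subset`: only vectors of `𝒦` have balls `B(Rw, R)` missing the
`R`-cone. Under c) this applies to every `w` in the spherical hull, since the hull lies in the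
normal cone. Under b) each such `w` has a small ball `B(τw, τ)` missing the set, and unique
projection lets it grow to radius `R` (`infDist_smul_of_ball_subset_Unp`).

For a → b, `exists_radius_of_nearest` places an outside point `y` on the radius from its nearest
point `p` to some `R • v`. If `dist y p < R`, the closed ball around `y` through `p` meets the
complement of `B(Rv, R)` only at `p`, so `p` is unique. -/

theorem mem_RCone_iff {R : ℝ} (hR : 0 < R) {𝒦 : Set 𝔼} (hK : 𝒦 ⊆ Metric.sphere 0 1) {x : 𝔼} :
    x ∈ RCone R 𝒦 ↔ ∀ v ∈ 𝒦, 2 * R * inner ℝ x v ≤ ‖x‖ ^ 2 := by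
  simp only [RCone, Set.mem_iInter, Set.mem_compl_iff, Metric.mem_ball, not_lt]
  refine forall₂_congr fun v hv => ?_
  have hv1 : ‖v‖ = 1 := by simpa using hK hv
  have h : ‖x - R • v‖ ^ 2 = ‖x‖ ^ 2 - 2 * R * inner ℝ x v + R ^ 2 := by
    rw [norm_sub_sq_real, inner_smul_right, norm_smul, hv1, Real.norm_of_nonneg hR.le]
    ring
  rw [dist_eq_norm, ← sq_le_sq₀ hR.le (norm_nonneg _), h]
  constructor <;> intro h <;> linarith

theorem isClosed_RCone (R : ℝ) (𝒦 : Set 𝔼) : IsClosed (RCone R 𝒦) :=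
  isClosed_biInter fun _ _ => Metric.isOpen_ball.isClosed_compl

theorem zero_mem_RCone {R : ℝ} (hR : 0 < R) {𝒦 : Set 𝔼} (hK : 𝒦 ⊆ Metric.sphere 0 1) :
    (0 : 𝔼) ∈ RCone R 𝒦 := by
  simp [mem_RCone_iff hR hK]

theorem smul_mem_RCone_of_inner_nonpos {R : ℝ} (hR : 0 < R) {𝒦 : Set 𝔼}
    (hK : 𝒦 ⊆ Metric.sphere 0 1) {w : 𝔼} (hw : ∀ v ∈ 𝒦, inner ℝ w v ≤ 0) {t : ℝ} (ht : 0 ≤ t) :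
    t • w ∈ RCone R 𝒦 := by
  rw [mem_RCone_iff hR hK]
  intro v hv
  rw [real_inner_smul_left]
  have h : 2 * R * (t * inner ℝ w v) ≤ 0 :=
    mul_nonpos_of_nonneg_of_nonpos (by positivity)
      (mul_nonpos_of_nonneg_of_nonpos ht (hw v hv))
  exact h.trans (sq_nonneg _)

/-- A unit vector `w` such that the ball `B(R w, R)` misses the `R`-cone of `𝒦` lies in `𝒦`. -/
theorem mem_of_RCone_subset {R : ℝ} (hR : 0 < R) {𝒦 : Set 𝔼} (hc : IsClosed 𝒦)
    (hK : 𝒦 ⊆ Metric.sphere 0 1) {w : 𝔼} (hw : ‖w‖ = 1)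
    (h : ∀ x ∈ RCone R 𝒦, 2 * R * inner ℝ x w ≤ ‖x‖ ^ 2) : w ∈ 𝒦 := by
  by_contra hwK
  have hcomp : IsCompact 𝒦 := (isCompact_sphere (0 : 𝔼) 1).of_isClosed_subset hc hK
  have hlt : ∀ v ∈ 𝒦, inner ℝ w v < 1 := by
    intro v hv
    have hv1 : ‖v‖ = 1 := by simpa using hK hv
    exact (inner_lt_one_iff_real_of_norm_eq_one hw hv1).2 fun e => hwK (e ▸ hv)
  obtain ⟨m, hm0, hm1, hm⟩ : ∃ m : ℝ, 0 < m ∧ m < 1 ∧ ∀ v ∈ 𝒦, inner ℝ w v ≤ m := by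
    rcases 𝒦.eq_empty_or_nonempty with he | hne
    · exact ⟨1 / 2, by norm_num, by norm_num, by simp [he]⟩
    · obtain ⟨v₀, hv₀, hmax⟩ := hcomp.exists_isMaxOn hne
        (f := fun v : 𝔼 => (inner ℝ w v : ℝ)) (by fun_prop)
      -- The `1 / 2` only keeps `m` positive, so that the test point below is nonzero.
      exact ⟨max (1 / 2) (inner ℝ w v₀), by positivity, max_lt (by norm_num) (hlt v₀ hv₀),
        fun v hv => (hmax hv).trans (le_max_right _ _)⟩
  -- For `x = s • w` the inequality for `v` reads `2R⟪w, v⟫ ≤ s`. The choice `s = 2Rm` satisfies it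
  -- for all `v ∈ 𝒦` but violates it for `w`, because `m < 1`.
  have hmem : (2 * R * m) • w ∈ RCone R 𝒦 := by
    rw [mem_RCone_iff hR hK]
    intro v hv
    rw [real_inner_smul_left, norm_smul, hw, mul_one, Real.norm_eq_abs, sq_abs]
    have := mul_le_mul_of_nonneg_left (hm v hv) (show 0 ≤ 2 * R * (2 * R * m) by positivity)
    nlinarith
  have := h _ hmem
  rw [real_inner_smul_left, real_inner_self_eq_norm_sq, norm_smul, hw, mul_one,
    Real.norm_eq_abs, sq_abs] at this
  have hp : 0 < 4 * R ^ 2 * m := by positivity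
  nlinarith

/-! ### Cones and polarity -/

theorem subset_relatedCone (𝒦 : Set 𝔼) : 𝒦 ⊆ relatedCone 𝒦 :=
  fun v hv => ⟨v, hv, 1, zero_le_one, (one_smul ℝ v).symm⟩

theorem subset_sphHull {𝒦 : Set 𝔼} (hK : 𝒦 ⊆ Metric.sphere 0 1) : 𝒦 ⊆ sphHull 𝒦 :=
  fun _ hv => ⟨subset_convexHull ℝ _ (subset_relatedCone 𝒦 hv), hK hv⟩

theorem smul_mem_relatedCone {𝒦 : Set 𝔼} {x : 𝔼} (hx : x ∈ relatedCone 𝒦) {t : ℝ} (ht : 0 ≤ t) :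
    t • x ∈ relatedCone 𝒦 := by
  obtain ⟨v, hv, c, hc, rfl⟩ := hx
  exact ⟨v, hv, t * c, mul_nonneg ht hc, smul_smul _ _ _⟩

theorem smul_mem_convexHull_relatedCone {𝒦 : Set 𝔼} {x : 𝔼}
    (hx : x ∈ convexHull ℝ (relatedCone 𝒦)) {t : ℝ} (ht : 0 ≤ t) :
    t • x ∈ convexHull ℝ (relatedCone 𝒦) := by
  have h : t • x ∈ t • convexHull ℝ (relatedCone 𝒦) := Set.smul_mem_smul_set hx
  rw [← convexHull_smul] at h
  refine convexHull_mono ?_ h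
  rintro _ ⟨y, hy, rfl⟩
  exact smul_mem_relatedCone hy ht

theorem SphConvex.convex_relatedCone {𝒦 : Set 𝔼} (hne : 𝒦.Nonempty) (h : SphConvex 𝒦) :
    Convex ℝ (relatedCone 𝒦) := by
  have heq : convexHull ℝ (relatedCone 𝒦) = relatedCone 𝒦 := by
    refine Set.Subset.antisymm (fun x hx => ?_) (subset_convexHull ℝ _)
    rcases eq_or_ne x 0 with rfl | hx0
    · obtain ⟨v, hv⟩ := hne
      exact ⟨v, hv, 0, le_rfl, (zero_smul ℝ v).symm⟩
    · have hpos : 0 < ‖x‖ := norm_pos_iff.2 hx0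
      refine ⟨‖x‖⁻¹ • x, ?_, ‖x‖, hpos.le, ?_⟩
      · rw [← h]
        refine ⟨smul_mem_convexHull_relatedCone hx (inv_nonneg.2 hpos.le), ?_⟩
        simp [norm_smul, hpos.ne']
      · rw [smul_smul, mul_inv_cancel₀ hpos.ne', one_smul]
  rw [← heq]
  exact convex_convexHull ℝ _

theorem isClosed_relatedCone {𝒦 : Set 𝔼} (hc : IsClosed 𝒦) (hK : 𝒦 ⊆ Metric.sphere 0 1) :
    IsClosed (relatedCone 𝒦) := by
  have hcomp : IsCompact 𝒦 := (isCompact_sphere (0 : 𝔼) 1).of_isClosed_subset hc hK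
  refine IsSeqClosed.isClosed fun x y hx hxy => ?_
  choose v hv c hc0 hxc using hx
  have hcx : ∀ n, c n = ‖x n‖ := fun n => by
    have hv1 : ‖v n‖ = 1 := by simpa using hK (hv n)
    rw [hxc, norm_smul, hv1, mul_one, Real.norm_of_nonneg (hc0 n)]
  obtain ⟨a, ha, φ, hφ, hlim⟩ := hcomp.tendsto_subseq hv
  refine ⟨a, ha, ‖y‖, norm_nonneg _, ?_⟩
  have hxφ : Tendsto (x ∘ φ) atTop (𝓝 y) := hxy.comp hφ.tendsto_atTop
  refine tendsto_nhds_unique hxφ ((hxφ.norm.smul hlim).congr fun n => ?_)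
  simp only [Function.comp]
  rw [← hcx, ← hxc]

/-- The bipolar theorem for the cone over a spherically convex set. -/
theorem SphConvex.mem_relatedCone_of_bipolar {𝒦 : Set 𝔼} (hne : 𝒦.Nonempty) (hc : IsClosed 𝒦)
    (hK : 𝒦 ⊆ Metric.sphere 0 1) (h : SphConvex 𝒦) {y : 𝔼}
    (hy : ∀ w : 𝔼, (∀ v ∈ 𝒦, inner ℝ w v ≤ 0) → inner ℝ y w ≤ 0) : y ∈ relatedCone 𝒦 := by
  by_contra hy'
  obtain ⟨f, u, hf, hfy⟩ := geometric_hahn_banach_closed_point (h.convex_relatedCone hne)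
    (isClosed_relatedCone hc hK) hy'
  have hu : 0 < u := by
    obtain ⟨v, hv⟩ := hne
    simpa using hf 0 ⟨v, hv, 0, le_rfl, (zero_smul ℝ v).symm⟩
  set w := (InnerProductSpace.toDual ℝ 𝔼).symm f with hw
  have hwf : ∀ x : 𝔼, inner ℝ w x = f x := fun x => InnerProductSpace.toDual_symm_apply
  have hwK : ∀ v ∈ 𝒦, inner ℝ w v ≤ 0 := by
    intro v hv
    rw [hwf]
    by_contra! hpos
    have := hf ((u / f v) • v) (smul_mem_relatedCone (subset_relatedCone 𝒦 hv) (by positivity))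
    rw [map_smul, smul_eq_mul, div_mul_cancel₀ _ hpos.ne'] at this
    exact this.false
  have := hy w hwK
  rw [real_inner_comm, hwf] at this
  linarith

/-- Tangent vectors at the origin are polar to `𝒦`. -/
theorem inner_nonpos_of_mem_Tan {R : ℝ} (hR : 0 < R) {𝒦 : Set 𝔼} (hK : 𝒦 ⊆ Metric.sphere 0 1)
    {w : 𝔼} (hw : w ∈ Tan (RCone R 𝒦) 0) {v : 𝔼} (hv : v ∈ 𝒦) : inner ℝ w v ≤ 0 := by
  have hv1 : ‖v‖ = 1 := by simpa using hK hv
  -- `r‖x‖` stays bounded while `‖x‖ < ε`, so the quadratic term `r‖x‖²` vanishes in the limit.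
  have key : ∀ ε : ℝ, 0 < ε → inner ℝ w v ≤ (‖w‖ + ε) * ε / (2 * R) + ε := by
    intro ε hε
    obtain ⟨x, ⟨hxC, hxε⟩, r, hr, hlt⟩ := hw ε hε
    rw [sub_zero] at hlt
    have hx : ‖x‖ < ε := by simpa using hxε
    have h1 := (mem_RCone_iff hR hK).1 hxC v hv
    have h2 : inner ℝ (w - r • x) v ≤ ε := by
      refine (real_inner_le_norm _ _).trans ?_
      rw [hv1, mul_one, norm_sub_rev]
      exact hlt.le
    have h3 : r * ‖x‖ ≤ ‖w‖ + ε := by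
      have := norm_add_le (r • x - w) w
      rw [sub_add_cancel, norm_smul, Real.norm_of_nonneg hr.le] at this
      linarith
    rw [inner_sub_left, real_inner_smul_left] at h2
    have h4 : r * inner ℝ x v ≤ (‖w‖ + ε) * ε / (2 * R) := by
      rw [le_div_iff₀ (by positivity)]
      calc r * inner ℝ x v * (2 * R) = r * (2 * R * inner ℝ x v) := by ring
        _ ≤ r * ‖x‖ ^ 2 := mul_le_mul_of_nonneg_left h1 hr.le
        _ = r * ‖x‖ * ‖x‖ := by ring
        _ ≤ (‖w‖ + ε) * ε := mul_le_mul h3 hx.le (norm_nonneg _) (by positivity)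
    linarith
  have hlim : Tendsto (fun ε : ℝ => (‖w‖ + ε) * ε / (2 * R) + ε) (𝓝[>] 0) (𝓝 0) := by
    have : Continuous (fun ε : ℝ => (‖w‖ + ε) * ε / (2 * R) + ε) := by fun_prop
    simpa using (this.tendsto 0).mono_left nhdsWithin_le_nhds
  exact ge_of_tendsto hlim (eventually_mem_nhdsWithin.mono fun ε hε => key ε hε)

theorem mem_Tan_of_inner_nonpos {R : ℝ} (hR : 0 < R) {𝒦 : Set 𝔼} (hK : 𝒦 ⊆ Metric.sphere 0 1)
    {w : 𝔼} (hw : ∀ v ∈ 𝒦, inner ℝ w v ≤ 0) : w ∈ Tan (RCone R 𝒦) 0 := by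
  intro ε hε
  have hn : 0 < ‖w‖ + 1 := by positivity
  have ht : 0 < ε / (‖w‖ + 1) := by positivity
  refine ⟨(ε / (‖w‖ + 1)) • w, ⟨smul_mem_RCone_of_inner_nonpos hR hK hw ht.le, ?_⟩,
    (ε / (‖w‖ + 1))⁻¹, inv_pos.2 ht, ?_⟩
  · rw [mem_ball_zero_iff, norm_smul, Real.norm_of_nonneg ht.le, div_mul_eq_mul_div,
      div_lt_iff₀ hn]
    nlinarith
  · rw [sub_zero, smul_smul, inv_mul_cancel₀ ht.ne', one_smul, sub_self, norm_zero]
    exact hε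

theorem mem_Nor_RCone_iff {R : ℝ} (hR : 0 < R) {𝒦 : Set 𝔼} (hK : 𝒦 ⊆ Metric.sphere 0 1) {y : 𝔼} :
    y ∈ Nor (RCone R 𝒦) 0 ↔ ∀ w : 𝔼, (∀ v ∈ 𝒦, inner ℝ w v ≤ 0) → inner ℝ y w ≤ 0 :=
  ⟨fun h w hw => h w (mem_Tan_of_inner_nonpos hR hK hw),
    fun h w hw => h w fun _ hv => inner_nonpos_of_mem_Tan hR hK hw hv⟩

theorem sphHull_subset_unitNor {R : ℝ} (hR : 0 < R) {𝒦 : Set 𝔼} (hK : 𝒦 ⊆ Metric.sphere 0 1) :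
    sphHull 𝒦 ⊆ unitNor (RCone R 𝒦) 0 := by
  rintro y ⟨hy, hy1⟩
  refine ⟨(mem_Nor_RCone_iff hR hK).2 fun w hw => ?_, hy1⟩
  have hsub : relatedCone 𝒦 ⊆ {x : 𝔼 | inner ℝ w x ≤ 0} := by
    rintro _ ⟨v, hv, c, hc, rfl⟩
    rw [Set.mem_ofPred_eq, real_inner_smul_right]
    exact mul_nonpos_of_nonneg_of_nonpos hc (hw v hv)
  have hconv : Convex ℝ {x : 𝔼 | inner ℝ w x ≤ 0} :=
    convex_halfSpace_le (innerₗ 𝔼 w).isLinear 0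
  rw [real_inner_comm]
  exact convexHull_min hsub hconv hy

theorem mem_of_mem_relatedCone {𝒦 : Set 𝔼} (hK : 𝒦 ⊆ Metric.sphere 0 1) {y : 𝔼}
    (hy : y ∈ relatedCone 𝒦) (hy1 : ‖y‖ = 1) : y ∈ 𝒦 := by
  obtain ⟨v, hv, c, hc, rfl⟩ := hy
  have hv1 : ‖v‖ = 1 := by simpa using hK hv
  rw [norm_smul, hv1, mul_one, Real.norm_of_nonneg hc] at hy1
  rwa [hy1, one_smul]

theorem SphConvex.unitNor_eq {R : ℝ} (hR : 0 < R) {𝒦 : Set 𝔼} (hne : 𝒦.Nonempty)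
    (hc : IsClosed 𝒦) (hK : 𝒦 ⊆ Metric.sphere 0 1) (h : SphConvex 𝒦) :
    unitNor (RCone R 𝒦) 0 = 𝒦 := by
  refine Set.Subset.antisymm ?_ ((subset_sphHull hK).trans (sphHull_subset_unitNor hR hK))
  rintro y ⟨hy, hy1⟩
  exact mem_of_mem_relatedCone hK
    (h.mem_relatedCone_of_bipolar hne hc hK ((mem_Nor_RCone_iff hR hK).1 hy)) (by simpa using hy1)

/-- The spherical hull consists of unit normals, so by hypothesis its balls already miss the
`R`-cone of `𝒦`. -/
theorem sphConvex_of_RCone_eq {R : ℝ} (hR : 0 < R) {𝒦 : Set 𝔼} (hc : IsClosed 𝒦)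
    (hK : 𝒦 ⊆ Metric.sphere 0 1) (h : RCone R 𝒦 = RCone R (unitNor (RCone R 𝒦) 0)) :
    SphConvex 𝒦 := by
  refine Set.Subset.antisymm (fun w hw => ?_) (subset_sphHull hK)
  refine mem_of_RCone_subset hR hc hK (by simpa using hw.2) fun x hx => ?_
  rw [h] at hx
  exact (mem_RCone_iff hR Set.inter_subset_right).1 hx w (sphHull_subset_unitNor hR hK hw)

/-! ### Extending touching balls in sets of positive reach -/

/-- At a point outside `A` with a unique nearest point, the distance function to `A` grows with
a rate arbitrarily close to one in some direction. -/
theorem exists_infDist_gt_of_mem_Unp {A : Set 𝔼} (hA : IsClosed A) {y : 𝔼} (hy : y ∈ Unp A)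
    (hpos : 0 < Metric.infDist y A) {k : ℝ} (hk : k < 1) :
    ∃ u : 𝔼, ‖u‖ = 1 ∧ ∀ᶠ h : ℝ in 𝓝[>] 0,
      Metric.infDist y A + k * h < Metric.infDist (y + h • u) A := by
  obtain ⟨p, ⟨hpA, hp⟩, hpu⟩ := hy
  have hne : A.Nonempty := ⟨p, hpA⟩
  set δ := Metric.infDist y A with hδ
  have hnp : ‖y - p‖ = δ := by rw [← dist_eq_norm, hp]
  refine ⟨δ⁻¹ • (y - p), by rw [norm_smul, hnp, Real.norm_of_nonneg (inv_nonneg.2 hpos.le),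
    inv_mul_cancel₀ hpos.ne'], ?_⟩
  set u := δ⁻¹ • (y - p) with hu
  have hu1 : ‖u‖ = 1 := by
    rw [norm_smul, hnp, Real.norm_of_nonneg (inv_nonneg.2 hpos.le), inv_mul_cancel₀ hpos.ne']
  by_contra hcon
  rw [not_eventually] at hcon
  -- Nearest points of `y + h n • u` subconverge to a nearest point of `y`, hence to `p`. Thus `⟪y -
  -- z, u⟫` tends to `δ`, whereas squaring the failed inequality bounds it asymptotically by `kδ`.
  obtain ⟨h, hlim, hbad⟩ := exists_seq_forall_of_frequently hcon
  have hh0 : Tendsto h atTop (𝓝 0) := hlim.mono_right nhdsWithin_le_nhds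
  have hhpos : ∀ᶠ n in atTop, 0 < h n := hlim.eventually eventually_mem_nhdsWithin
  choose z hzA hz using fun n => hA.exists_infDist_eq_dist hne (y + h n • u)
  have hyh : Tendsto (fun n => y + h n • u) atTop (𝓝 y) := by
    simpa using tendsto_const_nhds.add (hh0.smul_const u)
  have hdist : Tendsto (fun n => Metric.infDist (y + h n • u) A) atTop (𝓝 δ) :=
    ((Metric.continuous_infDist_pt A).tendsto y).comp hyh
  have hbdd : ∀ᶠ n in atTop, z n ∈ Metric.closedBall y (δ + 2) := by
    filter_upwards [hdist.eventually (gt_mem_nhds (show δ < δ + 1 by linarith)),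
      hyh.eventually (Metric.ball_mem_nhds y one_pos)] with n h1 h2
    rw [hz n] at h1
    rw [Metric.mem_closedBall]
    have := dist_triangle_left (z n) y (y + h n • u)
    linarith
  obtain ⟨q, -, φ, hφ, hq⟩ := (isCompact_closedBall y (δ + 2)).tendsto_subseq' hbdd.frequently
  have hqA : q ∈ A := hA.mem_of_tendsto hq (Eventually.of_forall fun n => hzA _)
  have hqp : q = p := by
    refine hpu q ⟨hqA, ?_⟩
    have h1 : Tendsto (fun n => dist (y + h (φ n) • u) (z (φ n))) atTop (𝓝 (dist y q)) :=
      (hyh.comp hφ.tendsto_atTop).dist hq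
    have h2 : Tendsto (fun n => dist (y + h (φ n) • u) (z (φ n))) atTop (𝓝 δ) :=
      (hdist.comp hφ.tendsto_atTop).congr fun n => hz _
    exact tendsto_nhds_unique h1 h2
  subst hqp
  have hinner : Tendsto (fun n => 2 * inner ℝ (y - z (φ n)) u - k ^ 2 * h (φ n)) atTop
      (𝓝 (2 * δ)) := by
    have h1 : Tendsto (fun n => inner ℝ (y - z (φ n)) u) atTop (𝓝 (inner ℝ (y - q) u : ℝ)) :=
      (tendsto_const_nhds.sub hq).inner tendsto_const_nhds
    have h2 : inner ℝ (y - q) u = δ := by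
      rw [hu, real_inner_smul_right, real_inner_self_eq_norm_sq, hnp]
      field_simp
    rw [h2] at h1
    simpa using (h1.const_mul 2).sub ((hh0.comp hφ.tendsto_atTop).const_mul (k ^ 2))
  have hlt : 2 * k * δ < 2 * δ := by nlinarith
  obtain ⟨n, hn1, hn2⟩ := ((hinner.eventually (lt_mem_nhds hlt)).and
    (hφ.tendsto_atTop.eventually hhpos)).exists
  have hb := not_lt.1 (hbad (φ n))
  rw [hz, dist_eq_norm] at hb
  have hsq : ‖y + h (φ n) • u - z (φ n)‖ ^ 2 =
      ‖y - z (φ n)‖ ^ 2 + 2 * h (φ n) * inner ℝ (y - z (φ n)) u + h (φ n) ^ 2 := by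
    rw [add_sub_right_comm, norm_add_sq_real, real_inner_smul_right, norm_smul, hu1, mul_one,
      Real.norm_eq_abs, sq_abs]
    ring
  have hle : δ ≤ ‖y - z (φ n)‖ := by
    rw [← dist_eq_norm]
    exact Metric.infDist_le_dist_of_mem (hzA _)
  have hb2 := pow_le_pow_left₀ (norm_nonneg _) hb 2
  rw [hsq] at hb2
  have hle2 := pow_le_pow_left₀ hpos.le hle 2
  have := mul_lt_mul_of_pos_left hn1 hn2
  nlinarith [sq_nonneg (h (φ n))]

/-- If the open ball `B(o, R)` consists of points with a unique nearest point in `A`, then a ball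
touching `A` only at the origin may be enlarged to radius `t < R`. -/
theorem infDist_smul_of_ball_subset_Unp {A : Set 𝔼} (hA : IsClosed A) (h0 : (0 : 𝔼) ∈ A) {R : ℝ}
    (hU : Metric.ball 0 R ⊆ Unp A) {w : 𝔼} (hw : ‖w‖ = 1) {τ : ℝ} (hτ : 0 < τ)
    (hτA : Metric.infDist (τ • w) A = τ) {t : ℝ} (hτt : τ ≤ t) (htR : t < R) :
    Metric.infDist (t • w) A = t := by
  have hs : 0 ≤ t - τ := sub_nonneg.2 hτt
  have hnτ : ‖τ • w‖ = τ := by rw [norm_smul, hw, mul_one, Real.norm_of_nonneg hτ.le]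
  -- Maximize `infDist y A - k * dist y (τ • w)`. An interior maximum is impossible, since the
  -- distance to `A` can still grow at a rate above `k`; so the maximizer lies on the bounding
  -- sphere.
  have key : ∀ k : ℝ, 0 ≤ k → k < 1 →
      ∃ y ∈ Metric.closedBall (τ • w) (t - τ), τ + k * (t - τ) ≤ Metric.infDist y A := by
    intro k hk0 hk1
    have hcont : Continuous fun y : 𝔼 => Metric.infDist y A - k * dist y (τ • w) :=
      (Metric.continuous_infDist_pt A).sub (by fun_prop)
    obtain ⟨y, hy, hmax⟩ := (isCompact_closedBall (τ • w) (t - τ)).exists_isMaxOn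
      ⟨_, Metric.mem_closedBall_self hs⟩ hcont.continuousOn
    have hmax' : ∀ z ∈ Metric.closedBall (τ • w) (t - τ),
        Metric.infDist z A - k * dist z (τ • w) ≤ Metric.infDist y A - k * dist y (τ • w) :=
      fun z hz => hmax hz
    have hy0 := hmax' _ (Metric.mem_closedBall_self hs)
    rw [dist_self, mul_zero, sub_zero, hτA] at hy0
    refine ⟨y, hy, ?_⟩
    rcases (Metric.mem_closedBall.1 hy).eq_or_lt with heq | hlt
    · rw [heq] at hy0
      linarith
    · exfalso
      have hkd : 0 ≤ k * dist y (τ • w) := mul_nonneg hk0 dist_nonneg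
      have hyU : y ∈ Unp A := by
        refine hU ?_
        rw [mem_ball_zero_iff]
        have := norm_le_norm_add_norm_sub' y (τ • w)
        rw [← dist_eq_norm, hnτ] at this
        linarith
      obtain ⟨u, hu1, hu⟩ := exists_infDist_gt_of_mem_Unp hA hyU (by linarith) hk1
      have hsmall : ∀ᶠ h : ℝ in 𝓝[>] 0, h < t - τ - dist y (τ • w) :=
        (gt_mem_nhds (sub_pos.2 hlt)).filter_mono nhdsWithin_le_nhds
      obtain ⟨h, ⟨h1, h2⟩, h3⟩ := ((hu.and hsmall).and eventually_mem_nhdsWithin).exists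
      have h3 : 0 < h := h3
      have hd : dist (y + h • u) (τ • w) ≤ h + dist y (τ • w) := by
        refine (dist_triangle _ y _).trans_eq ?_
        rw [dist_eq_norm (y + h • u) y, add_sub_cancel_left, norm_smul, hu1, mul_one,
          Real.norm_of_nonneg h3.le]
      have h4 := hmax' (y + h • u) (Metric.mem_closedBall.2 (by linarith))
      have h5 := mul_le_mul_of_nonneg_left hd hk0
      linarith
  obtain ⟨y, hy, hmax⟩ := (isCompact_closedBall (τ • w) (t - τ)).exists_isMaxOn
    ⟨_, Metric.mem_closedBall_self hs⟩ (Metric.continuous_infDist_pt A).continuousOn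
  have hyt : t ≤ Metric.infDist y A := by
    have hlim : Tendsto (fun k : ℝ => τ + k * (t - τ)) (𝓝[<] 1) (𝓝 t) := by
      have : Continuous fun k : ℝ => τ + k * (t - τ) := by fun_prop
      simpa using (this.tendsto 1).mono_left nhdsWithin_le_nhds
    refine le_of_tendsto hlim ?_
    filter_upwards [Ico_mem_nhdsLT (zero_lt_one' ℝ)] with k hk
    obtain ⟨z, hz, hle⟩ := key k hk.1 hk.2
    exact hle.trans (hmax hz)
  have hyn : t ≤ ‖y‖ := hyt.trans (by simpa using Metric.infDist_le_dist_of_mem (x := y) h0)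
  -- The ball of radius `t - τ` around `τ • w` touches the sphere of radius `t` around the origin
  -- from inside, only at `t • w`. Algebraically, `τ‖y - tw‖² = t‖y - τw‖² - (t - τ)‖y‖² + tτ(t - τ)
  -- ≤ 0`.
  have hyeq : y = t • w := by
    rw [Metric.mem_closedBall, dist_eq_norm] at hy
    have h1 : ‖y - τ • w‖ ^ 2 = ‖y‖ ^ 2 - 2 * τ * inner ℝ y w + τ ^ 2 := by
      rw [norm_sub_sq_real, hnτ, real_inner_smul_right]
      ring
    have h2 := pow_le_pow_left₀ (norm_nonneg _) hy 2
    have h3 : ‖y - t • w‖ ^ 2 = ‖y‖ ^ 2 - 2 * t * inner ℝ y w + t ^ 2 := by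
      rw [norm_sub_sq_real, norm_smul, hw, mul_one, Real.norm_eq_abs, sq_abs,
        real_inner_smul_right]
      ring
    have h4 := pow_le_pow_left₀ (hτ.le.trans hτt) hyn 2
    have h5 : τ * ‖y - t • w‖ ^ 2 ≤ 0 := by
      have h6 : t * (‖y‖ ^ 2 - 2 * τ * inner ℝ y w + τ ^ 2) ≤ t * (t - τ) ^ 2 :=
        mul_le_mul_of_nonneg_left (h1 ▸ h2) (hτ.le.trans hτt)
      have h7 := mul_le_mul_of_nonneg_left h4 hs
      rw [h3]
      nlinarith
    have h8 : ‖y - t • w‖ ^ 2 ≤ 0 := nonpos_of_mul_nonpos_right h5 hτ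
    exact sub_eq_zero.1 (norm_eq_zero.1 (pow_eq_zero_iff two_ne_zero |>.1
      (le_antisymm h8 (sq_nonneg _))))
  rw [← hyeq]
  refine le_antisymm ?_ hyt
  have hup := Metric.infDist_le_dist_of_mem (x := y) h0
  rwa [dist_zero_right, hyeq, norm_smul, hw, mul_one,
    Real.norm_of_nonneg (hτ.le.trans hτt), ← hyeq] at hup

/-! ### Reach at least `R` forces spherical convexity -/

theorem ball_subset_Unp_of_le_reach {A : Set 𝔼} {R : ℝ} (h : ENNReal.ofReal R ≤ reach A)
    {a : 𝔼} (ha : a ∈ A) : Metric.ball a R ⊆ Unp A := by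
  intro x hx
  have hx' : dist x a < R := hx
  have hlt : ENNReal.ofReal (dist x a) < reachAt A a :=
    ((ENNReal.ofReal_lt_ofReal_iff (dist_nonneg.trans_lt hx')).2 hx').trans_le
      (h.trans (iInf₂_le a ha))
  obtain ⟨_, ⟨ρ, hρ, hsub, rfl⟩, hlt⟩ := lt_sSup_iff.1 hlt
  exact hsub ((ENNReal.ofReal_lt_ofReal_iff hρ).1 hlt)

theorem le_reach_of_infDist_lt {A : Set 𝔼} {R : ℝ} (hR : 0 < R)
    (h : ∀ y, Metric.infDist y A < R → y ∈ Unp A) : ENNReal.ofReal R ≤ reach A :=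
  le_iInf₂ fun _ ha => le_sSup
    ⟨R, hR, fun y hy => h y ((Metric.infDist_le_dist_of_mem ha).trans_lt hy), rfl⟩

/-- Elements of the cone over `𝒦` satisfy a quadratic bound on the `R`-cone. -/
theorem exists_inner_le_of_mem_convexHull {R : ℝ} (hR : 0 < R) {𝒦 : Set 𝔼}
    (hK : 𝒦 ⊆ Metric.sphere 0 1) {w : 𝔼} (hw : w ∈ convexHull ℝ (relatedCone 𝒦)) :
    ∃ M : ℝ, 0 ≤ M ∧ ∀ x ∈ RCone R 𝒦, inner ℝ x w ≤ M * ‖x‖ ^ 2 := by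
  refine convexHull_min (t := {w : 𝔼 | ∃ M : ℝ, 0 ≤ M ∧ ∀ x ∈ RCone R 𝒦,
    inner ℝ x w ≤ M * ‖x‖ ^ 2}) ?_ ?_ hw
  · rintro _ ⟨v, hv, c, hc, rfl⟩
    refine ⟨c / (2 * R), by positivity, fun x hx => ?_⟩
    have := mul_le_mul_of_nonneg_left ((mem_RCone_iff hR hK).1 hx v hv) hc
    rw [real_inner_smul_right, div_mul_eq_mul_div, le_div_iff₀ (by positivity)]
    linarith
  · rintro v ⟨M, hM, hv⟩ w ⟨N, hN, hw⟩ a b ha hb -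
    refine ⟨a * M + b * N, by positivity, fun x hx => ?_⟩
    rw [inner_add_right, real_inner_smul_right, real_inner_smul_right]
    have h1 := mul_le_mul_of_nonneg_left (hv x hx) ha
    have h2 := mul_le_mul_of_nonneg_left (hw x hx) hb
    linarith

theorem le_infDist_smul_iff {A : Set 𝔼} (hne : A.Nonempty) {w : 𝔼} (hw : ‖w‖ = 1) {t : ℝ}
    (ht : 0 ≤ t) :
    t ≤ Metric.infDist (t • w) A ↔ ∀ x ∈ A, 2 * t * inner ℝ x w ≤ ‖x‖ ^ 2 := by
  rw [Metric.le_infDist hne]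
  refine forall₂_congr fun x _ => ?_
  have h : ‖x - t • w‖ ^ 2 = ‖x‖ ^ 2 - 2 * t * inner ℝ x w + t ^ 2 := by
    rw [norm_sub_sq_real, norm_smul, hw, mul_one, Real.norm_eq_abs, sq_abs,
      real_inner_smul_right]
    ring
  rw [dist_comm, dist_eq_norm, ← sq_le_sq₀ ht (norm_nonneg _), h]
  constructor <;> intro h <;> linarith

/-- Only the reach at the origin matters: a small touching ball grows to every radius `t < R`, and
`t → R` gives the required inequality. -/
theorem sphConvex_of_le_reach {R : ℝ} (hR : 0 < R) {𝒦 : Set 𝔼} (hc : IsClosed 𝒦)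
    (hK : 𝒦 ⊆ Metric.sphere 0 1) (h : ENNReal.ofReal R ≤ reach (RCone R 𝒦)) :
    SphConvex 𝒦 := by
  refine Set.Subset.antisymm (fun w hw => ?_) (subset_sphHull hK)
  have hw1 : ‖w‖ = 1 := by simpa using hw.2
  have h0 := zero_mem_RCone hR hK
  have hne : (RCone R 𝒦).Nonempty := ⟨0, h0⟩
  refine mem_of_RCone_subset hR hc hK hw1 fun x hx => ?_
  obtain ⟨M, hM, hMx⟩ := exists_inner_le_of_mem_convexHull hR hK hw.1
  obtain ⟨τ, hτ, hτR, hτM⟩ : ∃ τ : ℝ, 0 < τ ∧ τ < R ∧ 2 * τ * M ≤ 1 := by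
    refine ⟨min (R / 2) (1 / (2 * (M + 1))), by positivity,
      (min_le_left _ _).trans_lt (by linarith), ?_⟩
    have h1 : min (R / 2) (1 / (2 * (M + 1))) ≤ 1 / (2 * (M + 1)) := min_le_right _ _
    rw [le_div_iff₀ (by positivity)] at h1
    have h2 : 0 < min (R / 2) (1 / (2 * (M + 1))) := by positivity
    nlinarith
  have hτA : Metric.infDist (τ • w) (RCone R 𝒦) = τ := by
    refine le_antisymm ?_ ((le_infDist_smul_iff hne hw1 hτ.le).2 fun z hz => ?_)
    · refine (Metric.infDist_le_dist_of_mem h0).trans_eq ?_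
      rw [dist_zero_right, norm_smul, hw1, mul_one, Real.norm_of_nonneg hτ.le]
    · have h1 := mul_le_mul_of_nonneg_left (hMx z hz) (show 0 ≤ 2 * τ by positivity)
      have h2 := mul_le_mul_of_nonneg_right hτM (sq_nonneg ‖z‖)
      linarith
  have hlim : Tendsto (fun t : ℝ => 2 * t * inner ℝ x w) (𝓝[<] R) (𝓝 (2 * R * inner ℝ x w)) := by
    have : Continuous fun t : ℝ => 2 * t * (inner ℝ x w : ℝ) := by fun_prop
    exact (this.tendsto R).mono_left nhdsWithin_le_nhds
  refine le_of_tendsto hlim ?_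
  filter_upwards [Ico_mem_nhdsLT hτR] with t ht
  have := infDist_smul_of_ball_subset_Unp (isClosed_RCone R 𝒦) h0
    (ball_subset_Unp_of_le_reach h h0) hw1 hτ hτA ht.1 ht.2
  exact (le_infDist_smul_iff hne hw1 (hτ.le.trans ht.1)).1 this.ge x hx

/-! ### The reach of the `R`-cone of a spherically convex set -/

/-- If `p` lies in the `R`-cone and the ray from `p` in direction `e` meets its complement
arbitrarily close to `p`, then `p` lies on some generating sphere, whose inner normal does not form
an obtuse angle with `e`. -/
theorem exists_active_of_frequently_notMem {R : ℝ} (hR : 0 < R) {𝒦 : Set 𝔼} (hc : IsClosed 𝒦)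
    (hK : 𝒦 ⊆ Metric.sphere 0 1) {p : 𝔼} (hp : p ∈ RCone R 𝒦) {e : 𝔼}
    (he : ∃ᶠ t : ℝ in 𝓝[>] 0, p + t • e ∉ RCone R 𝒦) :
    ∃ v ∈ 𝒦, 2 * R * inner ℝ p v = ‖p‖ ^ 2 ∧ 0 ≤ inner ℝ e (R • v - p) := by
  have hcomp : IsCompact 𝒦 := (isCompact_sphere (0 : 𝔼) 1).of_isClosed_subset hc hK
  obtain ⟨t, hlim, hbad⟩ := exists_seq_forall_of_frequently he
  have ht0 : Tendsto t atTop (𝓝 0) := hlim.mono_right nhdsWithin_le_nhds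
  have htpos : ∀ᶠ n in atTop, 0 < t n := hlim.eventually eventually_mem_nhdsWithin
  simp only [mem_RCone_iff hR hK, not_forall, not_le] at hbad
  choose v hv hlt using hbad
  obtain ⟨a, ha, φ, hφ, hva⟩ := hcomp.tendsto_subseq hv
  have htφ : Tendsto (t ∘ φ) atTop (𝓝 0) := ht0.comp hφ.tendsto_atTop
  have hpt : Tendsto (fun n => p + t (φ n) • e) atTop (𝓝 p) := by
    simpa using tendsto_const_nhds.add (htφ.smul_const e)
  refine ⟨a, ha, le_antisymm ((mem_RCone_iff hR hK).1 hp a ha) ?_, ?_⟩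
  · exact le_of_tendsto_of_tendsto (hpt.norm.pow 2) ((hpt.inner hva).const_mul (2 * R))
      (Eventually.of_forall fun n => (hlt (φ n)).le)
  · have h1 : Tendsto (fun n => 2 * R * inner ℝ e (v (φ n)) - 2 * inner ℝ p e -
        t (φ n) * ‖e‖ ^ 2) atTop (𝓝 (2 * R * inner ℝ e a - 2 * inner ℝ p e)) := by
      have h2 : Tendsto (fun n => inner ℝ e (v (φ n))) atTop (𝓝 (inner ℝ e a : ℝ)) :=
        tendsto_const_nhds.inner hva
      simpa using ((h2.const_mul (2 * R)).sub_const (2 * inner ℝ p e)).sub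
        (htφ.mul_const (‖e‖ ^ 2))
    have h3 : 0 ≤ 2 * R * inner ℝ e a - 2 * inner ℝ p e := by
      refine ge_of_tendsto h1 ?_
      filter_upwards [hφ.tendsto_atTop.eventually htpos] with n hn
      have h4 := hlt (φ n)
      have h5 := (mem_RCone_iff hR hK).1 hp _ (hv (φ n))
      rw [norm_add_sq_real, inner_add_left, real_inner_smul_left, real_inner_smul_right,
        norm_smul, Real.norm_of_nonneg hn.le] at h4
      have h6 : 0 < t (φ n) * (2 * R * inner ℝ e (v (φ n)) - 2 * inner ℝ p e -
          t (φ n) * ‖e‖ ^ 2) := by nlinarith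
      exact (pos_of_mul_pos_right h6 hn.le).le
    rw [inner_sub_right, real_inner_smul_right, real_inner_comm p e]
    rw [real_inner_comm e p] at h3 ⊢
    linarith

/-- Over a spherically convex set, at most one generating sphere passes through a point of the
`R`-cone other than its vertex. -/
theorem SphConvex.active_unique {R : ℝ} (hR : 0 < R) {𝒦 : Set 𝔼} (hK : 𝒦 ⊆ Metric.sphere 0 1)
    (h : SphConvex 𝒦) {p : 𝔼} (hp : p ∈ RCone R 𝒦) (hp0 : p ≠ 0) {v w : 𝔼} (hv : v ∈ 𝒦)
    (hw : w ∈ 𝒦) (hpv : 2 * R * inner ℝ p v = ‖p‖ ^ 2) (hpw : 2 * R * inner ℝ p w = ‖p‖ ^ 2) :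
    v = w := by
  have hv1 : ‖v‖ = 1 := by simpa using hK hv
  have hw1 : ‖w‖ = 1 := by simpa using hK hw
  have hppos : 0 < ‖p‖ ^ 2 := by positivity
  -- The midpoint also satisfies the equality at `p`. Its normalization lies in `𝒦`, and the
  -- inequality there forces `‖m‖ ≥ 1`, which for unit vectors means `v = w`.
  set m : 𝔼 := (1 / 2 : ℝ) • v + (1 / 2 : ℝ) • w with hm
  have hpm : 2 * R * inner ℝ p m = ‖p‖ ^ 2 := by
    rw [hm, inner_add_right, real_inner_smul_right, real_inner_smul_right]
    linarith
  have hm0 : m ≠ 0 := by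
    intro h0
    rw [h0, inner_zero_right, mul_zero] at hpm
    exact hppos.ne hpm
  have hmpos : 0 < ‖m‖ := norm_pos_iff.2 hm0
  have hmhull : m ∈ convexHull ℝ (relatedCone 𝒦) :=
    convex_convexHull ℝ _ (subset_convexHull ℝ _ (subset_relatedCone 𝒦 hv))
      (subset_convexHull ℝ _ (subset_relatedCone 𝒦 hw)) (by norm_num) (by norm_num) (by norm_num)
  have hmK : ‖m‖⁻¹ • m ∈ 𝒦 := by
    rw [← h]
    exact ⟨smul_mem_convexHull_relatedCone hmhull (inv_nonneg.2 hmpos.le),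
      by simp [norm_smul, hmpos.ne']⟩
  have h1 := (mem_RCone_iff hR hK).1 hp _ hmK
  rw [real_inner_smul_right, ← mul_assoc, mul_comm (2 * R), mul_assoc, hpm,
    inv_mul_le_iff₀ hmpos] at h1
  have hm1 : 1 ≤ ‖m‖ := by
    by_contra! hlt
    nlinarith
  have hmsq : ‖m‖ ^ 2 = 1 / 2 + 1 / 2 * inner ℝ v w := by
    rw [hm, norm_add_sq_real, norm_smul, norm_smul, hv1, hw1, real_inner_smul_left,
      real_inner_smul_right]
    norm_num
    ring
  refine (inner_eq_one_iff_of_norm_eq_one (𝕜 := ℝ) hv1 hw1).1 (le_antisymm ?_ ?_)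
  · simpa [hv1, hw1] using real_inner_le_norm v w
  · nlinarith

/-- The nearest point map of the `R`-cone moves along the radii of the generating balls. -/
theorem SphConvex.exists_radius_of_nearest {R : ℝ} (hR : 0 < R) {𝒦 : Set 𝔼} (hne : 𝒦.Nonempty)
    (hc : IsClosed 𝒦) (hK : 𝒦 ⊆ Metric.sphere 0 1) (h : SphConvex 𝒦) {y p : 𝔼}
    (hy : y ∉ RCone R 𝒦) (hp : p ∈ RCone R 𝒦)
    (hyp : dist y p = Metric.infDist y (RCone R 𝒦)) :
    ∃ v ∈ 𝒦, ‖p - R • v‖ = R ∧ R • (y - p) = dist y p • (R • v - p) := by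
  have hyp0 : y - p ≠ 0 := fun e => hy (sub_eq_zero.1 e ▸ hp)
  have hδ : 0 < ‖y - p‖ := norm_pos_iff.2 hyp0
  have hnear : ∀ x ∈ RCone R 𝒦, ‖y - p‖ ^ 2 ≤ ‖y - x‖ ^ 2 := by
    intro x hx
    refine pow_le_pow_left₀ (norm_nonneg _) ?_ 2
    rw [← dist_eq_norm, ← dist_eq_norm, hyp]
    exact Metric.infDist_le_dist_of_mem hx
  rcases eq_or_ne p 0 with rfl | hp0
  · rw [sub_zero] at hδ
    have hycone : y ∈ relatedCone 𝒦 := by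
      refine h.mem_relatedCone_of_bipolar hne hc hK fun w hw => ?_
      by_contra! hpos
      have hw0 : w ≠ 0 := by
        rintro rfl
        simp at hpos
      have hwn : 0 < ‖w‖ ^ 2 := by positivity
      -- The point used is the projection of `y` to the ray of `w`; it would be closer to `y` than
      -- the origin.
      have h1 := hnear _ (smul_mem_RCone_of_inner_nonpos hR hK hw
        (div_pos hpos hwn).le)
      rw [sub_zero, norm_sub_sq_real, real_inner_smul_right, norm_smul, mul_pow,
        Real.norm_eq_abs, sq_abs] at h1
      have h2 : (inner ℝ y w / ‖w‖ ^ 2) ^ 2 * ‖w‖ ^ 2 =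
          inner ℝ y w / ‖w‖ ^ 2 * inner ℝ y w := by field_simp
      have h3 : 0 < inner ℝ y w / ‖w‖ ^ 2 * inner ℝ y w := by positivity
      linarith
    obtain ⟨v, hv, c, hc0, rfl⟩ := hycone
    have hv1 : ‖v‖ = 1 := by simpa using hK hv
    refine ⟨v, hv, ?_, ?_⟩
    · rw [zero_sub, norm_neg, norm_smul, hv1, mul_one, Real.norm_of_nonneg hR.le]
    · rw [sub_zero, sub_zero, dist_zero_right, norm_smul, hv1, mul_one,
        Real.norm_of_nonneg hc0, smul_comm]
  -- Moving from `p` at an acute angle to `y - p` brings the point closer to `y`, so it must leave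
  -- the `R`-cone.
  · have hnot : ∀ e : 𝔼, 0 < inner ℝ e (y - p) →
        ∃ᶠ t : ℝ in 𝓝[>] 0, p + t • e ∉ RCone R 𝒦 := by
      intro e he
      refine Eventually.frequently ?_
      have hlim : Tendsto (fun t : ℝ => 2 * inner ℝ e (y - p) - t * ‖e‖ ^ 2) (𝓝[>] 0)
          (𝓝 (2 * inner ℝ e (y - p))) := by
        have : Continuous fun t : ℝ => 2 * (inner ℝ e (y - p) : ℝ) - t * ‖e‖ ^ 2 := by fun_prop
        simpa using (this.tendsto 0).mono_left nhdsWithin_le_nhds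
      filter_upwards [hlim.eventually (lt_mem_nhds (by positivity : 0 < 2 * inner ℝ e (y - p))),
        eventually_mem_nhdsWithin] with t h1 ht hmem
      have ht : 0 < t := ht
      have h2 := hnear _ hmem
      rw [← sub_sub, norm_sub_sq_real (y - p), real_inner_smul_right, norm_smul,
        Real.norm_of_nonneg ht.le, real_inner_comm] at h2
      have := mul_pos ht h1
      nlinarith
    obtain ⟨v, hv, hpv, -⟩ := exists_active_of_frequently_notMem hR hc hK hp
      (hnot (y - p) (by rw [real_inner_self_eq_norm_sq]; positivity))
    have hv1 : ‖v‖ = 1 := by simpa using hK hv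
    have hpn : ‖R • v - p‖ = R := by
      rw [← sq_eq_sq₀ (norm_nonneg _) hR.le, norm_sub_sq_real, real_inner_smul_left, norm_smul,
        hv1, Real.norm_of_nonneg hR.le, real_inner_comm]
      linarith
    refine ⟨v, hv, by rw [norm_sub_rev, hpn], ?_⟩
    rw [dist_eq_norm]
    by_contra hneq
    have hlt : inner ℝ (y - p) (R • v - p) < ‖y - p‖ * R := by
      have hlt := inner_lt_norm_mul_iff_real (F := 𝔼) (x := y - p) (y := R • v - p)
      rw [hpn] at hlt
      exact hlt.2 hneq
    -- As a difference of distinct vectors of equal norm, `e` is acute to `y - p` and obtuse to `R •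
    -- v - p`. The former yields an active generator, which must be `v`; the latter contradicts it.
    set e : 𝔼 := R • (y - p) - ‖y - p‖ • (R • v - p) with he
    have he1 : 0 < inner ℝ e (y - p) := by
      rw [he, inner_sub_left, real_inner_smul_left, real_inner_smul_left,
        real_inner_self_eq_norm_sq, real_inner_comm]
      nlinarith
    have he2 : inner ℝ e (R • v - p) < 0 := by
      rw [he, inner_sub_left, real_inner_smul_left, real_inner_smul_left,
        real_inner_self_eq_norm_sq, hpn]
      nlinarith
    obtain ⟨v', hv', hpv', hge⟩ := exists_active_of_frequently_notMem hR hc hK hp (hnot e he1)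
    rw [← h.active_unique hR hK hp hp0 hv hv' hpv hpv'] at hge
    exact hge.not_gt he2

theorem SphConvex.le_reach {R : ℝ} (hR : 0 < R) {𝒦 : Set 𝔼} (hne : 𝒦.Nonempty)
    (hc : IsClosed 𝒦) (hK : 𝒦 ⊆ Metric.sphere 0 1) (h : SphConvex 𝒦) :
    ENNReal.ofReal R ≤ reach (RCone R 𝒦) := by
  refine le_reach_of_infDist_lt hR fun y hyR => ?_
  by_cases hy : y ∈ RCone R 𝒦
  · have h0 : Metric.infDist y (RCone R 𝒦) = 0 := Metric.infDist_zero_of_mem hy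
    exact ⟨y, ⟨hy, by rw [h0, dist_self]⟩,
      fun b hb => (dist_eq_zero.1 (hb.2.trans h0)).symm⟩
  obtain ⟨p, hp, hyp⟩ := (isClosed_RCone R 𝒦).exists_infDist_eq_dist ⟨0, zero_mem_RCone hR hK⟩ y
  refine ⟨p, ⟨hp, hyp.symm⟩, ?_⟩
  rintro q ⟨hq, hyq⟩
  obtain ⟨v, hv, hpv, hrad⟩ := h.exists_radius_of_nearest hR hne hc hK hy hp hyp.symm
  set ρ := dist y p with hρ
  have hρR : ρ < R := hyp ▸ hyR
  have hyp' : ‖y - p‖ = ρ := (dist_eq_norm _ _).symm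
  have hyq' : ‖y - q‖ = ρ := by rw [← dist_eq_norm, hyq, hyp]
  have hq' : R ≤ ‖q - R • v‖ := by
    have := Set.mem_iInter₂.1 hq v hv
    rwa [Set.mem_compl_iff, Metric.mem_ball, not_lt, dist_eq_norm] at this
  -- Expand everything in terms of `q - p` and `y - p`.
  have h1 : ‖q - R • v‖ ^ 2 =
      ‖q - p‖ ^ 2 - 2 * inner ℝ (q - p) (R • v - p) + R ^ 2 := by
    rw [← sub_sub_sub_cancel_right q (R • v) p, norm_sub_sq_real, norm_sub_rev (R • v) p, hpv]
  have h2 : ‖y - q‖ ^ 2 = ρ ^ 2 - 2 * inner ℝ (q - p) (y - p) + ‖q - p‖ ^ 2 := by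
    rw [← sub_sub_sub_cancel_right y q p, norm_sub_sq_real, hyp', real_inner_comm]
  have h3 : R * inner ℝ (q - p) (y - p) = ρ * inner ℝ (q - p) (R • v - p) := by
    rw [← real_inner_smul_right (q - p), ← real_inner_smul_right (q - p), hrad]
  have h4 := pow_le_pow_left₀ hR.le hq' 2
  rw [h1] at h4
  rw [hyq'] at h2
  have hρ0 : 0 ≤ ρ := dist_nonneg
  have h5 : (R - ρ) * ‖q - p‖ ^ 2 ≤ 0 := by
    have := mul_le_mul_of_nonneg_left h4 hρ0
    nlinarith
  have h6 : ‖q - p‖ ^ 2 ≤ 0 := nonpos_of_mul_nonpos_right h5 (sub_pos.2 hρR)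
  exact sub_eq_zero.1 (norm_eq_zero.1 (pow_eq_zero_iff two_ne_zero |>.1
    (le_antisymm h6 (sq_nonneg _))))

end RBody

theorem mainTheorem3 {d : ℕ} (R : ℝ) (hR : 0 < R)
    (𝒦 : Set (EuclideanSpace ℝ (Fin d))) (hne : 𝒦.Nonempty) (hclosed : IsClosed 𝒦)
    (hhemi : ∃ u ∈ Metric.sphere (0 : EuclideanSpace ℝ (Fin d)) 1, 𝒦 ⊆ RBody.hemisphere u) :
    List.TFAE
      [RBody.SphConvex 𝒦,
        ENNReal.ofReal R ≤ RBody.reach (RBody.RCone R 𝒦),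
        RBody.RCone R 𝒦 = RBody.RCone R (RBody.unitNor (RBody.RCone R 𝒦) 0)] := by
  obtain ⟨u, -, hu⟩ := hhemi
  have hK : 𝒦 ⊆ Metric.sphere 0 1 := fun v hv => (hu hv).1
  tfae_have 1 → 2 := fun h => h.le_reach hR hne hclosed hK
  tfae_have 2 → 1 := fun h => RBody.sphConvex_of_le_reach hR hclosed hK h
  tfae_have 1 → 3 := fun h => by rw [h.unitNor_eq hR hne hclosed hK]
  tfae_have 3 → 1 := fun h => RBody.sphConvex_of_RCone_eq hR hclosed hK h
  tfae_finish
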